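/- For real $a>0$ let $\zeta(s,a)$ be the Hurwitz zeta function, i.e. the analytic continuation to $s\in\mathbb{C}\setminus\{1\}$ of $\sum_{r\ge 0}(a+r)^{-s}$ ($\operatorname{Re}s>1$). For real $p>0$, by the real zeros of $\zeta(-p,\cdot)$ we mean the real numbers $a>0$ with $\zeta(-p,a)=0$. Theorem. There is a real number $P>1$ such that for every real $p>P$ the function $\zeta(-p,\cdot)$ has at least one and only finitely many real zeros; the largest one, $A(p)$, satisfies $$\frac{p-1}{2\pi e}-\frac12 < A(p) < \frac{p}{2\pi e}+\frac{1}{4\pi e}\log p+1,$$ the number $N(p)$ of (distinct) real zeros satisfies $$\frac{p-1}{\pi e}-1 < N(p) < \frac{p-1}{\pi e}+\frac12\log p+2\pi e+2,$$ and every zero $a$ of $\zeta(-p,\cdot)$ with $0<a<\frac{p-1}{2\pi e}$ is simple, i.e. $\zeta(-p,\cdot)$ is differentiable at $a$ with nonzero derivative. Consequently $N(p)/p\to \frac{1}{\pi e}$ as $p\to\infty$. Moreover, these zeros are asymptotically located on the half-integer lattice $\frac p4+\frac12\mathbb{Z}$: for every $\varepsilon>0$ there is $P_\varepsilon$ such that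 for every real $p>P_\varepsilon$ and every zero $a$ of $\zeta(-p,\cdot)$ with $0<a<\frac{p-1}{2\pi e}$ there is $l\in\mathbb{Z}$ with $\left|a-\left(\frac p4+\frac l2\right)\right|<\varepsilon$. -/

import Mathlib

open Filter Topology

/-- The integer `n ≥ 0` in the decomposition `a = n + b`, `0 < b ≤ 1`, of a real number `a > 0`. -/
noncomputable def intShift (a : ℝ) : ℕ := ⌈a⌉₊ - 1

/-- The Hurwitz zeta function `ζ(s, a)` for an arbitrary real parameter `a > 0`. Mathlib's
`HurwitzZeta.hurwitzZeta` is the case `0 < a ≤ 1` (its parameter lives in `ℝ / ℤ`); for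
`a = n + b` with `0 < b ≤ 1` the first `n` terms of the series for `ζ(s, b)` are removed.
The lemmas `hasSum_hurwitz` and `differentiableAt_hurwitz` below show that this is the analytic
continuation in `s` to `ℂ \ {1}` of the series `∑ 1 / (a + r) ^ s`. -/
noncomputable def hurwitz (s : ℂ) (a : ℝ) : ℂ :=
  HurwitzZeta.hurwitzZeta (a : UnitAddCircle) s -
    ∑ r ∈ Finset.range (intShift a), 1 / ((r : ℂ) + ((a - intShift a : ℝ) : ℂ)) ^ s

theorem intShift_mem {a : ℝ} (ha : 0 < a) :
    0 < a - intShift a ∧ a - intShift a ≤ 1 := by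
  have h1 : 1 ≤ ⌈a⌉₊ := Nat.one_le_ceil_iff.mpr ha
  have h2 : (intShift a : ℝ) = (⌈a⌉₊ : ℝ) - 1 := by
    unfold intShift
    push_cast [Nat.cast_sub h1]
    ring
  have h3 := Nat.le_ceil a
  have h4 := Nat.ceil_lt_add_one ha.le
  rw [h2]
  constructor <;> linarith

/-- For `Re s > 1` the function is the sum of the defining series. -/
theorem hasSum_hurwitz {a : ℝ} (ha : 0 < a) {s : ℂ} (hs : 1 < s.re) :
    HasSum (fun r : ℕ => 1 / ((a : ℂ) + (r : ℂ)) ^ s) (hurwitz s a) := by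
  obtain ⟨h0, h1⟩ := intShift_mem ha
  have h := HurwitzZeta.hasSum_hurwitzZeta_of_one_lt_re
    (a := a - intShift a) ⟨h0.le, h1⟩ hs
  have hc : (((a - intShift a : ℝ)) : UnitAddCircle) = (a : UnitAddCircle) := by
    rw [AddCircle.coe_sub]
    have : ((intShift a : ℝ) : UnitAddCircle) = 0 := by
      rw [AddCircle.coe_eq_zero_iff]
      exact ⟨intShift a, by simp⟩
    rw [this, sub_zero]
  rw [hc, ← hasSum_nat_add_iff' (intShift a)] at h
  unfold hurwitz
  refine h.congr_fun ?_
  intro r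
  congr 2
  push_cast
  ring

/-- The function is holomorphic in `s` away from `s = 1`. -/
theorem differentiableAt_hurwitz {a : ℝ} (ha : 0 < a) {s : ℂ} (hs : s ≠ 1) :
    DifferentiableAt ℂ (fun z => hurwitz z a) s := by
  obtain ⟨h0, -⟩ := intShift_mem ha
  unfold hurwitz
  refine (HurwitzZeta.differentiableAt_hurwitzZeta _ hs).sub ?_
  refine DifferentiableAt.fun_sum fun r _ => ?_
  have hne : (r : ℂ) + ((a - intShift a : ℝ) : ℂ) ≠ 0 := by
    have : (0 : ℝ) < (r : ℝ) + (a - intShift a) := by positivity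
    exact_mod_cast this.ne'
  refine (differentiableAt_const _).div (differentiableAt_id.const_cpow (Or.inl hne)) ?_
  exact fun h => hne ((Complex.cpow_eq_zero_iff _ _).1 h).1

/-- The set of real zeros of `ζ(-p, ·)`, whose domain is `(0, ∞)`. -/
def realZeros (p : ℝ) : Set ℝ := {a : ℝ | 0 < a ∧ hurwitz (-(p : ℂ)) a = 0}

/-- `N(p)`, the number of real zeros of `ζ(-p, ·)`. -/
noncomputable def numRealZeros (p : ℝ) : ℕ := (realZeros p).ncard

/-! Hurwitz's formula gives `ζ(-p, a) = C_p (F_p(a) - S_p(a) / C_p)`, where `F_p` is 1-periodic,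
`S_p(a)` is the sum of `(a - k) ^ p` over `1 ≤ k ≤ a`, and `C_p` is `hurwitzConst p`. As `p → ∞`,
`F_p(a)` tends to `sin (2πa - πp/2)` uniformly in `a`, and by Stirling `C_p` is of order `√p (p /
2πe) ^ p`. Hence `S_p / C_p` is negligible for `a ≤ p / 2πe + K`, where the zeros follow those of
the sine, while its first term alone makes the function negative from `p / 2πe + log p / 4πe + 1`
on. In the window between, of length of order `log p`, no approximation is used. Instead,
`normHurwitz p` has derivative `2π * normHurwitz (p - 1)`, so differentiating `m` times moves the
region of negativity left by about `m / 2πe`. With `m` about `log p / 2` it covers the window, and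
Rolle's theorem bounds the number of zeros there by `m`. The same derivative formula gives
simplicity and separation of zeros in the oscillating range. -/

/-! ### Hurwitz's formula at `s = -p` -/

/-- The constant `2 Γ(p + 1) / (2π) ^ (p + 1)` of Hurwitz's formula for `ζ(-p, a)`. -/
noncomputable def hurwitzConst (p : ℝ) : ℝ :=
  2 * Real.Gamma (p + 1) / (2 * Real.pi) ^ (p + 1)

/-- The trigonometric series of Hurwitz's formula for `ζ(-p, a)`. -/
noncomputable def hurwitzSeries (p a : ℝ) : ℝ :=
  ∑' n : ℕ, Real.sin (2 * Real.pi * n * a - Real.pi * p / 2) / (n : ℝ) ^ (p + 1)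

/-- The sum of the powers `(a - k) ^ p` over the integers `k` with `1 ≤ k ≤ a`. -/
noncomputable def shiftSum (p a : ℝ) : ℝ :=
  ∑ k ∈ Finset.range ⌈a⌉₊, (max (a - (k + 1)) 0) ^ p

/-- The function `ζ(-p, a)`, normalised so that its oscillating part has amplitude about one. -/
noncomputable def normHurwitz (p a : ℝ) : ℝ :=
  hurwitzSeries p a - shiftSum p a / hurwitzConst p

theorem hurwitzConst_pos {p : ℝ} (hp : 0 < p) : 0 < hurwitzConst p := by
  have := Real.Gamma_pos_of_pos (show 0 < p + 1 by linarith)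
  unfold hurwitzConst
  positivity

theorem norm_hurwitzSeries_term_le (p a : ℝ) (n : ℕ) :
    ‖Real.sin (2 * Real.pi * n * a - Real.pi * p / 2) / (n : ℝ) ^ (p + 1)‖
      ≤ 1 / (n : ℝ) ^ (p + 1) := by
  have h : 0 ≤ (n : ℝ) ^ (p + 1) := by positivity
  rw [norm_div, Real.norm_of_nonneg h]
  exact div_le_div_of_nonneg_right (Real.abs_sin_le_one _) h

theorem summable_hurwitzSeries {p : ℝ} (hp : 0 < p) (a : ℝ) :
    Summable fun n : ℕ =>
      Real.sin (2 * Real.pi * n * a - Real.pi * p / 2) / (n : ℝ) ^ (p + 1) :=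
  Summable.of_norm_bounded (Real.summable_one_div_nat_rpow.mpr (by linarith))
    (norm_hurwitzSeries_term_le p a)

/-- Terms with `k + 1 ≥ a` vanish because `p ≠ 0`. A length that stays fixed near a given point is
what allows termwise differentiation later. -/
theorem shiftSum_eq (p : ℝ) (hp : 0 < p) {a : ℝ} {N : ℕ} (hN : a ≤ N) :
    shiftSum p a = ∑ k ∈ Finset.range N, (max (a - (k + 1)) 0) ^ p := by
  unfold shiftSum
  refine Finset.sum_subset (Finset.range_mono (Nat.ceil_le.mpr hN)) fun k _ hk => ?_
  have h1 : a ≤ k := Nat.ceil_le.mp (by simpa using hk)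
  rw [max_eq_right (by linarith), Real.zero_rpow hp.ne']

/-- The functional equation at `1 - s` with `s = p + 1`: the two conjugate exponential series add up
to twice a cosine series, which is the sine series with shifted phase. -/
theorem hurwitzZeta_neg_eq {p : ℝ} (hp : 0 < p) (a : ℝ) :
    HurwitzZeta.hurwitzZeta (a : UnitAddCircle) (-(p : ℂ))
      = ((hurwitzConst p * hurwitzSeries p a : ℝ) : ℂ) := by
  set s : ℂ := ((p + 1 : ℝ) : ℂ) with hs
  have hre : 1 < s.re := by rw [hs, Complex.ofReal_re]; linarith
  have h1 : (-(p : ℂ)) = 1 - s := by rw [hs]; push_cast; ring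
  have hsn : ∀ n : ℕ, s ≠ -n := fun n h => by
    have := congrArg Complex.re h
    simp at this
    have h0 : (0 : ℝ) ≤ n := n.cast_nonneg
    linarith
  have hs1 : s ≠ 1 := fun h => by rw [h] at hre; simp at hre
  rw [h1, HurwitzZeta.hurwitzZeta_one_sub _ hsn (Or.inr hs1)]
  have hA := (HurwitzZeta.hasSum_expZeta_of_one_lt_re a hre).mul_left
    (Complex.exp (-Real.pi * Complex.I * s / 2))
  have hB := (HurwitzZeta.hasSum_expZeta_of_one_lt_re (-a) hre).mul_left
    (Complex.exp (Real.pi * Complex.I * s / 2))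
  have hC := (summable_hurwitzSeries hp a).hasSum
  have hC' := (Complex.hasSum_ofReal.mpr hC).mul_left 2
  have hAB := hA.add hB
  have key : ∀ n : ℕ, Complex.exp (-Real.pi * Complex.I * s / 2) *
        (Complex.exp (2 * Real.pi * Complex.I * a * n) / n ^ s) +
      Complex.exp (Real.pi * Complex.I * s / 2) *
        (Complex.exp (2 * Real.pi * Complex.I * (-a : ℝ) * n) / n ^ s)
      = 2 * ((Real.sin (2 * Real.pi * n * a - Real.pi * p / 2) / (n : ℝ) ^ (p + 1) : ℝ) : ℂ) := by
    intro n
    have hn : ((n : ℂ)) ^ s = (((n : ℝ) ^ (p + 1) : ℝ) : ℂ) := by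
      rw [Complex.ofReal_cpow n.cast_nonneg, hs]; push_cast; rfl
    rw [hn, ← mul_div_assoc, ← mul_div_assoc, ← add_div, ← Complex.exp_add, ← Complex.exp_add,
      Complex.ofReal_div, ← mul_div_assoc]
    congr 1
    have hsin : Real.sin (2 * Real.pi * n * a - Real.pi * p / 2)
        = Real.cos (2 * Real.pi * n * a - Real.pi * (p + 1) / 2) := by
      rw [← Real.cos_sub_pi_div_two]; congr 1; ring
    rw [hsin, Complex.ofReal_cos, Complex.cos, mul_div_cancel₀ _ two_ne_zero, hs]
    push_cast
    congr 2 <;> ring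
  rw [← AddCircle.coe_neg, (hAB.congr_fun fun n => (key n).symm).unique hC']
  have hg : Complex.Gamma s = ((Real.Gamma (p + 1) : ℝ) : ℂ) := by
    rw [hs, Complex.Gamma_ofReal]
  have hpow : (2 * (Real.pi : ℂ)) ^ (-s) = (((2 * Real.pi) ^ (-(p + 1)) : ℝ) : ℂ) := by
    rw [Complex.ofReal_cpow (by positivity), hs]; push_cast; rfl
  rw [hg, hpow, hurwitzConst, Real.rpow_neg (by positivity), hurwitzSeries]
  push_cast
  ring

theorem sum_intShift_eq {p a : ℝ} (hp : 0 < p) (ha : 0 < a) :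
    ∑ r ∈ Finset.range (intShift a), 1 / ((r : ℂ) + ((a - intShift a : ℝ) : ℂ)) ^ (-(p : ℂ))
      = (shiftSum p a : ℂ) := by
  obtain ⟨h0, h1⟩ := intShift_mem ha
  have hN : shiftSum p a = ∑ k ∈ Finset.range (intShift a), (max (a - (k + 1)) 0) ^ p := by
    -- The last index contributes nothing, since `a - intShift a ≤ 1`.
    rw [shiftSum_eq p hp (N := intShift a + 1) (by push_cast; linarith), Finset.sum_range_succ,
      max_eq_right (by linarith), Real.zero_rpow hp.ne', add_zero]
  rw [hN, ← Finset.sum_range_reflect]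
  push_cast
  refine Finset.sum_congr rfl fun k hk => ?_
  have hk' : k + 1 ≤ intShift a := Finset.mem_range.mp hk
  have hkr : (k : ℝ) + 1 ≤ intShift a := by exact_mod_cast hk'
  rw [Complex.cpow_neg, one_div, inv_inv, max_eq_left (by linarith),
    Complex.ofReal_cpow (by linarith)]
  congr 1
  rw [show intShift a - 1 - k = intShift a - (k + 1) by omega, Nat.cast_sub hk']
  push_cast
  ring

theorem hurwitz_neg_eq {p a : ℝ} (hp : 0 < p) (ha : 0 < a) :
    hurwitz (-(p : ℂ)) a = ((hurwitzConst p * normHurwitz p a : ℝ) : ℂ) := by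
  have hc := (hurwitzConst_pos hp).ne'
  rw [hurwitz, hurwitzZeta_neg_eq hp, sum_intShift_eq hp ha, normHurwitz, mul_sub,
    mul_div_cancel₀ _ hc]
  push_cast
  ring

theorem mem_realZeros_iff {p a : ℝ} (hp : 0 < p) :
    a ∈ realZeros p ↔ 0 < a ∧ normHurwitz p a = 0 := by
  refine and_congr_right fun ha => ?_
  rw [hurwitz_neg_eq hp ha, Complex.ofReal_eq_zero, mul_eq_zero,
    or_iff_right (hurwitzConst_pos hp).ne']

/-! ### Differentiation in `a` lowers `p` by one -/

/-- This recursion gives the oscillating series and the power sum the same factor `2π` under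
differentiation. -/
theorem hurwitzConst_eq {p : ℝ} (hp : 0 < p) :
    hurwitzConst p * (2 * Real.pi) = p * hurwitzConst (p - 1) := by
  unfold hurwitzConst
  rw [sub_add_cancel, Real.Gamma_add_one hp.ne', Real.rpow_add_one (by positivity)]
  field_simp

theorem hasDerivAt_hurwitzSeries {p : ℝ} (hp : 1 < p) (a : ℝ) :
    HasDerivAt (hurwitzSeries p) (2 * Real.pi * hurwitzSeries (p - 1) a) a := by
  have hu : Summable fun n : ℕ => 2 * Real.pi * (1 / (n : ℝ) ^ p) :=
    (Real.summable_one_div_nat_rpow.mpr hp).mul_left _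
  have hder : ∀ (n : ℕ) (y : ℝ), HasDerivAt
      (fun x => Real.sin (2 * Real.pi * n * x - Real.pi * p / 2) / (n : ℝ) ^ (p + 1))
      (2 * Real.pi *
        (Real.sin (2 * Real.pi * n * y - Real.pi * (p - 1) / 2) / (n : ℝ) ^ (p - 1 + 1))) y := by
    intro n y
    have h1 : HasDerivAt (fun x => 2 * Real.pi * n * x - Real.pi * p / 2) (2 * Real.pi * n) y := by
      simpa using ((hasDerivAt_id y).const_mul (2 * Real.pi * n)).sub_const (Real.pi * p / 2)
    convert! h1.sin.div_const ((n : ℝ) ^ (p + 1)) using 1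
    rw [← Real.sin_add_pi_div_two, sub_add_cancel,
      show 2 * Real.pi * n * y - Real.pi * (p - 1) / 2
        = 2 * Real.pi * n * y - Real.pi * p / 2 + Real.pi / 2 by ring]
    rcases Nat.eq_zero_or_pos n with rfl | hn
    · simp [Real.zero_rpow (show p ≠ 0 by linarith)]
    · have hn' : (0 : ℝ) < n := by exact_mod_cast hn
      rw [Real.rpow_add_one hn'.ne']
      field_simp
  have h := hasDerivAt_tsum (y₀ := a) hu hder (fun n y => ?_)
    (summable_hurwitzSeries (by linarith) a) a
  · rw [tsum_mul_left] at h
    exact h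
  · rw [norm_mul, Real.norm_of_nonneg (by positivity : 0 ≤ 2 * Real.pi)]
    have := norm_hurwitzSeries_term_le (p - 1) y n
    rw [sub_add_cancel] at this ⊢
    gcongr

theorem hasDerivAt_max_zero_rpow {p : ℝ} (hp : 1 < p) (x : ℝ) :
    HasDerivAt (fun y : ℝ => (max y 0) ^ p) (p * (max x 0) ^ (p - 1)) x := by
  have hp1 : p - 1 ≠ 0 := by linarith
  rcases lt_trichotomy x 0 with hx | rfl | hx
  · rw [max_eq_right hx.le, Real.zero_rpow hp1, mul_zero]
    refine (hasDerivAt_const x (0 : ℝ)).congr_of_eventuallyEq ?_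
    filter_upwards [gt_mem_nhds hx] with y hy
    rw [max_eq_right hy.le, Real.zero_rpow (by linarith)]
  · rw [max_self, Real.zero_rpow hp1, mul_zero]
    have h0 : HasDerivAt (fun y : ℝ => y ^ p) 0 (0 : ℝ) := by
      simpa [Real.zero_rpow hp1] using
        Real.hasDerivAt_rpow_const (x := (0 : ℝ)) (p := p) (Or.inr hp.le)
    rw [hasDerivAt_iff_isLittleO_nhds_zero] at h0 ⊢
    -- At the kink, `|max y 0 ^ p| ≤ |y ^ p|`, so the zero derivative is inherited from `y ^ p`.
    refine Asymptotics.IsBigO.trans_isLittleO (Asymptotics.IsBigO.of_bound 1 ?_) h0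
    filter_upwards with y
    rcases le_total y 0 with hy | hy
    · simp [hy, Real.zero_rpow (show p ≠ 0 by linarith)]
    · simp [hy]
  · rw [max_eq_left hx.le]
    refine (Real.hasDerivAt_rpow_const (Or.inl hx.ne')).congr_of_eventuallyEq ?_
    filter_upwards [lt_mem_nhds hx] with y hy
    rw [max_eq_left (le_of_lt hy)]

theorem hasDerivAt_shiftSum {p : ℝ} (hp : 1 < p) (a : ℝ) :
    HasDerivAt (shiftSum p) (p * shiftSum (p - 1) a) a := by
  obtain ⟨N, hN⟩ := exists_nat_gt a
  rw [shiftSum_eq (p - 1) (by linarith) hN.le, Finset.mul_sum]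
  have h : HasDerivAt (fun x : ℝ => ∑ k ∈ Finset.range N, (max (x - (k + 1)) 0) ^ p)
      (∑ k ∈ Finset.range N, p * (max (a - (k + 1)) 0) ^ (p - 1)) a :=
    HasDerivAt.fun_sum fun k _ =>
      (hasDerivAt_max_zero_rpow hp (a - ((k : ℝ) + 1))).comp_sub_const a ((k : ℝ) + 1)
  refine h.congr_of_eventuallyEq ?_
  filter_upwards [gt_mem_nhds hN] with x hx
  exact shiftSum_eq p (by linarith) hx.le

theorem hasDerivAt_normHurwitz {p : ℝ} (hp : 1 < p) (a : ℝ) :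
    HasDerivAt (normHurwitz p) (2 * Real.pi * normHurwitz (p - 1) a) a := by
  refine ((hasDerivAt_hurwitzSeries hp a).sub
    ((hasDerivAt_shiftSum hp a).div_const (hurwitzConst p))).congr_deriv ?_
  have h1 := (hurwitzConst_pos (show 0 < p by linarith)).ne'
  have h2 := (hurwitzConst_pos (show 0 < p - 1 by linarith)).ne'
  have h3 := hurwitzConst_eq (show 0 < p by linarith)
  rw [normHurwitz]
  field_simp
  linear_combination (shiftSum (p - 1) a) * h3

theorem continuous_normHurwitz {p : ℝ} (hp : 1 < p) : Continuous (normHurwitz p) :=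
  continuous_iff_continuousAt.mpr fun a => (hasDerivAt_normHurwitz hp a).continuousAt

theorem hasDerivAt_hurwitz {p a : ℝ} (hp : 1 < p) (ha : 0 < a) :
    HasDerivAt (fun x : ℝ => hurwitz (-(p : ℂ)) x)
      ((hurwitzConst p * (2 * Real.pi * normHurwitz (p - 1) a) : ℝ) : ℂ) a := by
  refine ((hasDerivAt_normHurwitz hp a).const_mul (hurwitzConst p)).ofReal_comp
    |>.congr_of_eventuallyEq ?_
  filter_upwards [lt_mem_nhds ha] with x hx
  exact hurwitz_neg_eq (by linarith) hx

/-! ### Stirling bounds for `Γ` at real arguments -/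

/-- Log-convexity of `Γ` between `n + 1` and `n + 2`. -/
theorem Gamma_nat_add_le (n : ℕ) {x : ℝ} (hx0 : 0 ≤ x) (hx1 : x < 1) :
    Real.Gamma (n + x + 1) ≤ n.factorial * ((n : ℝ) + 1) ^ x := by
  rcases hx0.eq_or_lt with rfl | hx0
  · simp [Real.Gamma_nat_eq_factorial]
  have hn : (0 : ℝ) < (n : ℝ) + 1 := by positivity
  have hf : (0 : ℝ) < n.factorial := by positivity
  have h := Real.Gamma_mul_add_mul_le_rpow_Gamma_mul_rpow_Gamma hn
    (show 0 < (n : ℝ) + 1 + 1 by positivity) (sub_pos.mpr hx1) hx0 (by ring)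
  rw [Real.Gamma_add_one hn.ne', Real.Gamma_nat_eq_factorial,
    Real.mul_rpow hn.le hf.le] at h
  calc Real.Gamma (n + x + 1) = Real.Gamma ((1 - x) * (n + 1) + x * (n + 1 + 1)) := by
        congr 1; ring
    _ ≤ _ := h
    _ = (n.factorial : ℝ) ^ (1 - x + x) * ((n : ℝ) + 1) ^ x := by
        rw [Real.rpow_add hf]; ring
    _ = _ := by rw [sub_add_cancel, Real.rpow_one]

/-- Log-convexity again, now at `n + 1` as a point between `n + x` and `n + x + 1`. -/
theorem le_Gamma_nat_add {n : ℕ} (hn : 0 < n) {x : ℝ} (hx0 : 0 ≤ x) (hx1 : x < 1) :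
    n.factorial * ((n : ℝ) + x) ^ x ≤ Real.Gamma (n + x + 1) := by
  rcases hx0.eq_or_lt with rfl | hx0
  · simp [Real.Gamma_nat_eq_factorial]
  have hn' : (0 : ℝ) < n := by exact_mod_cast hn
  have hnx : (0 : ℝ) < n + x := by positivity
  have hG : 0 < Real.Gamma (n + x) := Real.Gamma_pos_of_pos hnx
  have h := Real.Gamma_mul_add_mul_le_rpow_Gamma_mul_rpow_Gamma hnx
    (show 0 < (n : ℝ) + x + 1 by positivity) hx0 (sub_pos.mpr hx1) (by ring)
  rw [show x * (n + x) + (1 - x) * (n + x + 1) = (n : ℝ) + 1 by ring,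
    Real.Gamma_nat_eq_factorial, Real.Gamma_add_one hnx.ne',
    Real.mul_rpow hnx.le hG.le] at h
  rw [Real.Gamma_add_one hnx.ne']
  calc _ ≤ _ := mul_le_mul_of_nonneg_right h (by positivity)
    _ = Real.Gamma (n + x) ^ (x + (1 - x)) * (n + x) ^ ((1 - x) + x) := by
        rw [Real.rpow_add hG, Real.rpow_add hnx]; ring
    _ = _ := by rw [sub_add_cancel, add_sub_cancel, Real.rpow_one, Real.rpow_one]; ring

/-- A Stirling type lower bound for the Gamma function at real arguments. -/
theorem sqrt_mul_le_Gamma {p : ℝ} (hp : 1 ≤ p) :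
    √p * (p / Real.exp 1) ^ p ≤ Real.Gamma (p + 1) := by
  have hp0 : 0 < p := by linarith
  obtain ⟨n, x, hx0, hx1, hn, rfl⟩ : ∃ (n : ℕ) (x : ℝ), 0 ≤ x ∧ x < 1 ∧ 0 < n ∧ p = n + x :=
    ⟨⌊p⌋₊, p - ⌊p⌋₊, sub_nonneg.mpr (Nat.floor_le hp0.le),
      by linarith [Nat.lt_floor_add_one p], Nat.floor_pos.mpr hp, by ring⟩
  have hn' : (0 : ℝ) < n := by exact_mod_cast hn
  have hn1 : (1 : ℝ) ≤ n := by exact_mod_cast hn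
  refine le_trans ?_ (le_Gamma_nat_add hn hx0 hx1)
  have h1 : √(n + x) ≤ √(2 * Real.pi * n) := by
    apply Real.sqrt_le_sqrt
    nlinarith [Real.pi_gt_three]
  -- After taking logarithms this is `n log (1 + x / n) ≤ x`.
  have h2 : ((n + x) / Real.exp 1) ^ (n + x) ≤ (n / Real.exp 1) ^ n * (n + x) ^ x := by
    have hlog : Real.log (n + x) - Real.log n ≤ x / n := by
      rw [← Real.log_div hp0.ne' hn'.ne']
      refine (Real.log_le_sub_one_of_pos (by positivity)).trans_eq ?_
      field_simp
      ring
    rw [← Real.log_le_log_iff (by positivity) (by positivity), Real.log_rpow (by positivity),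
      Real.log_mul (by positivity) (by positivity), Real.log_pow, Real.log_rpow hp0,
      Real.log_div hp0.ne' (by positivity), Real.log_div hn'.ne' (by positivity), Real.log_exp]
    have := mul_le_mul_of_nonneg_left hlog hn'.le
    rw [mul_div_cancel₀ _ hn'.ne'] at this
    linarith
  calc _ ≤ √(2 * Real.pi * n) * ((n / Real.exp 1) ^ n * (n + x) ^ x) := by gcongr
    _ ≤ _ := by
      rw [← mul_assoc]
      gcongr
      exact Stirling.le_factorial_stirling n

theorem eventually_factorial_le :
    ∀ᶠ n : ℕ in atTop,
      (n.factorial : ℝ) ≤ 21 / 20 * (√(2 * Real.pi * n) * (n / Real.exp 1) ^ n) := by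
  have hπ : √Real.pi < 21 / 20 * √Real.pi := by
    have : 0 < √Real.pi := by positivity
    linarith
  filter_upwards [Stirling.tendsto_stirlingSeq_sqrt_pi.eventually_lt_const hπ,
    eventually_gt_atTop 0] with n hn hn0
  have hn0' : (0 : ℝ) < n := by exact_mod_cast hn0
  rw [Stirling.stirlingSeq, div_lt_iff₀ (by positivity)] at hn
  refine hn.le.trans_eq ?_
  rw [show 2 * Real.pi * (n : ℝ) = Real.pi * (2 * n) by ring, Real.sqrt_mul Real.pi_pos.le]
  ring

/-- A Stirling type upper bound for the Gamma function at real arguments. -/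
theorem eventually_Gamma_le :
    ∀ᶠ p : ℝ in atTop,
      Real.Gamma (p + 1) ≤ 11 / 10 * (√(2 * Real.pi * p) * (p / Real.exp 1) ^ p) := by
  -- The factor `exp (1 / p)` is the cost of passing from `n` to `n + x`; `21/20 * 22/21 = 11/10`.
  have hexp : ∀ᶠ p : ℝ in atTop, Real.exp p⁻¹ < 22 / 21 := by
    have : Tendsto (fun p : ℝ => Real.exp p⁻¹) atTop (𝓝 1) := by
      have h := (Real.continuous_exp.tendsto 0).comp (tendsto_inv_atTop_zero (𝕜 := ℝ))
      rw [Real.exp_zero] at h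
      exact h
    exact this.eventually_lt_const (by norm_num)
  filter_upwards [tendsto_nat_floor_atTop.eventually eventually_factorial_le, hexp,
    eventually_ge_atTop 1] with p hfac hexp hp
  have hp0 : 0 < p := by linarith
  obtain ⟨n, x, hx0, hx1, hn, hfl, rfl⟩ :
      ∃ (n : ℕ) (x : ℝ), 0 ≤ x ∧ x < 1 ∧ 0 < n ∧ n = ⌊p⌋₊ ∧ p = n + x :=
    ⟨⌊p⌋₊, p - ⌊p⌋₊, sub_nonneg.mpr (Nat.floor_le hp0.le),
      by linarith [Nat.lt_floor_add_one p], Nat.floor_pos.mpr hp, rfl, by ring⟩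
  rw [← hfl] at hfac
  have hn' : (0 : ℝ) < n := by exact_mod_cast hn
  refine (Gamma_nat_add_le n hx0 hx1).trans ?_
  have h2 : (n / Real.exp 1) ^ n * ((n : ℝ) + 1) ^ x
      ≤ Real.exp (n + x)⁻¹ * ((n + x) / Real.exp 1) ^ (n + x) := by
    have hlog1 : Real.log n - Real.log (n + x) ≤ -(x / (n + x)) := by
      rw [← Real.log_div hn'.ne' hp0.ne']
      refine (Real.log_le_sub_one_of_pos (by positivity)).trans_eq ?_
      field_simp
      ring
    have hlog2 : Real.log (n + 1) - Real.log (n + x) ≤ (1 - x) / (n + x) := by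
      rw [← Real.log_div (by positivity) hp0.ne']
      refine (Real.log_le_sub_one_of_pos (by positivity)).trans_eq ?_
      field_simp
      ring
    rw [← Real.log_le_log_iff (by positivity) (by positivity),
      Real.log_mul (by positivity) (by positivity), Real.log_pow, Real.log_rpow (by positivity),
      Real.log_mul (by positivity) (by positivity), Real.log_rpow (by positivity),
      Real.log_div hp0.ne' (by positivity), Real.log_div hn'.ne' (by positivity), Real.log_exp,
      Real.log_exp]
    have e1 := mul_le_mul_of_nonneg_left hlog1 hn'.le
    have e2 := mul_le_mul_of_nonneg_left hlog2 hx0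
    have e3 : n * -(x / (n + x)) + x * ((1 - x) / (n + x)) + x = x * ((n : ℝ) + x)⁻¹ := by
      field_simp
      ring
    have e4 : x * ((n : ℝ) + x)⁻¹ ≤ ((n : ℝ) + x)⁻¹ :=
      mul_le_of_le_one_left (by positivity) hx1.le
    linarith
  calc (n.factorial : ℝ) * ((n : ℝ) + 1) ^ x
      ≤ 21 / 20 * (√(2 * Real.pi * n) * (n / Real.exp 1) ^ n) * ((n : ℝ) + 1) ^ x := by gcongr
    _ = 21 / 20 * (√(2 * Real.pi * n) * ((n / Real.exp 1) ^ n * ((n : ℝ) + 1) ^ x)) := by ring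
    _ ≤ 21 / 20 * (√(2 * Real.pi * (n + x)) *
          (22 / 21 * ((n + x) / Real.exp 1) ^ (n + x))) := by
        have h3 : √(2 * Real.pi * n) ≤ √(2 * Real.pi * (n + x)) := by
          gcongr
          linarith
        have h4 := h2.trans (mul_le_mul_of_nonneg_right hexp.le (by positivity))
        have := mul_le_mul h3 h4 (by positivity) (by positivity)
        linarith
    _ = _ := by ring

/-! ### The oscillating range and the range of negativity -/

/-- The terms with `n ≥ 2` are at most `(1/2) ^ (p - 1) / n ^ 2`, uniformly in `a`. -/
theorem eventually_abs_hurwitzSeries_sub_sin_le {δ : ℝ} (hδ : 0 < δ) :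
    ∀ᶠ p : ℝ in atTop, ∀ a : ℝ,
      |hurwitzSeries p a - Real.sin (2 * Real.pi * a - Real.pi * p / 2)| ≤ δ := by
  have hs : Summable fun n : ℕ => 1 / (n : ℝ) ^ 2 := Real.summable_one_div_nat_pow.mpr one_lt_two
  have hlim : Tendsto (fun p : ℝ => (1 / 2 : ℝ) ^ (p - 1) * ∑' n : ℕ, 1 / (n : ℝ) ^ 2)
      atTop (𝓝 0) := by
    have h1 : Tendsto (fun p : ℝ => (1 / 2 : ℝ) ^ (p - 1)) atTop (𝓝 0) :=
      (tendsto_rpow_atTop_of_base_lt_one _ (by norm_num) (by norm_num)).comp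
        (tendsto_atTop_add_const_right _ (-1) tendsto_id)
    have h2 := h1.mul_const (∑' n : ℕ, 1 / (n : ℝ) ^ 2)
    rwa [zero_mul] at h2
  filter_upwards [hlim.eventually_le_const hδ, eventually_gt_atTop 1] with p hp hp1 a
  refine le_trans ?_ hp
  have h1 := (summable_hurwitzSeries (show 0 < p by linarith) a).hasSum.sub
    (hasSum_ite_eq 1 (Real.sin (2 * Real.pi * a - Real.pi * p / 2)))
  have h2 := hs.hasSum.mul_left ((1 / 2 : ℝ) ^ (p - 1))
  change ‖hurwitzSeries p a - _‖ ≤ _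
  rw [hurwitzSeries, ← h1.tsum_eq]
  refine tsum_of_norm_bounded h2 fun n => ?_
  match n with
  | 0 => simp [Real.zero_rpow (show p + 1 ≠ 0 by linarith)]
  | 1 => simp; positivity
  | n + 2 =>
    rw [if_neg (by omega), sub_zero]
    refine (norm_hurwitzSeries_term_le p a (n + 2)).trans ?_
    have hn : (2 : ℝ) ≤ ((n + 2 : ℕ) : ℝ) := by push_cast; linarith [n.cast_nonneg (α := ℝ)]
    rw [show p + 1 = p - 1 + (2 : ℕ) by push_cast; ring, Real.rpow_add_natCast (by positivity),
      Real.div_rpow (by norm_num) (by norm_num), Real.one_rpow, div_mul_div_comm, one_mul]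
    gcongr

theorem hurwitzConst_eq_div (p : ℝ) {q : ℝ} (hp : 0 < p)
    (hq : Real.Gamma (p + 1) = q * (p / Real.exp 1) ^ p) :
    hurwitzConst p = q / Real.pi * (p / (2 * Real.pi * Real.exp 1)) ^ p := by
  rw [hurwitzConst, hq, Real.rpow_add_one (by positivity),
    show p / (2 * Real.pi * Real.exp 1) = p / Real.exp 1 / (2 * Real.pi) by field_simp,
    Real.div_rpow (x := p / Real.exp 1) (by positivity) (by positivity)]
  generalize (p / Real.exp 1) ^ p = w
  field_simp

theorem le_hurwitzConst {p : ℝ} (hp : 1 ≤ p) :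
    √p / Real.pi * (p / (2 * Real.pi * Real.exp 1)) ^ p ≤ hurwitzConst p := by
  have hp0 : 0 < p := by linarith
  have hpos : 0 < (p / Real.exp 1) ^ p := by positivity
  rw [hurwitzConst_eq_div p hp0 (div_mul_cancel₀ (Real.Gamma (p + 1)) hpos.ne').symm]
  gcongr
  exact (le_div_iff₀ hpos).mpr (sqrt_mul_le_Gamma hp)

theorem eventually_hurwitzConst_le :
    ∀ᶠ p : ℝ in atTop,
      hurwitzConst p ≤ 22 / 25 * √p * (p / (2 * Real.pi * Real.exp 1)) ^ p := by
  filter_upwards [eventually_Gamma_le, eventually_ge_atTop 1] with p hG hp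
  have hp0 : 0 < p := by linarith
  have hpos : 0 < (p / Real.exp 1) ^ p := by positivity
  rw [hurwitzConst_eq_div p hp0 (div_mul_cancel₀ (Real.Gamma (p + 1)) hpos.ne').symm]
  have h1 : Real.Gamma (p + 1) / (p / Real.exp 1) ^ p ≤ 11 / 10 * √(2 * Real.pi * p) := by
    rw [div_le_iff₀ hpos]
    linarith
  -- This needs only `π ≥ 25/8`; then `11/10 * 4/5 = 22/25`.
  have h2 : √(2 * Real.pi * p) ≤ 4 / 5 * Real.pi * √p := by
    rw [Real.sqrt_mul (by positivity)]
    gcongr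
    rw [Real.sqrt_le_left (by positivity)]
    nlinarith [Real.pi_gt_d2]
  gcongr
  rw [div_le_iff₀ Real.pi_pos]
  linarith

/-- From `M - k ≤ M exp (-k / M)` and `p ≥ M`, the `k`-th power is at most `M ^ p * exp (-k)`, hence
at most `M ^ p / 2 ^ k`. -/
theorem shiftSum_le_rpow {p a M : ℝ} (hM : 0 < M) (hMp : M ≤ p) (ha : a ≤ M) :
    shiftSum p a ≤ M ^ p := by
  have hp : 0 < p := by linarith
  have hgeom : HasSum (fun k : ℕ => M ^ p * (1 / 2 : ℝ) ^ (k + 1)) (M ^ p) := by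
    have := (hasSum_geometric_two.mul_right (1 / 2 : ℝ)).mul_left (M ^ p)
    simpa [pow_succ] using this
  refine le_trans (Finset.sum_le_sum fun k _ => ?_)
    (sum_le_hasSum _ (fun k _ => by positivity) hgeom)
  have h1 : max (a - (k + 1)) 0 ≤ M * Real.exp (-((k + 1) / M)) := by
    refine max_le ?_ (by positivity)
    have h := mul_le_mul_of_nonneg_left (Real.add_one_le_exp (-(((k : ℝ) + 1) / M))) hM.le
    have e : M * (-(((k : ℝ) + 1) / M) + 1) = M - (k + 1) := by
      field_simp
      ring
    linarith
  calc (max (a - (k + 1)) 0) ^ p ≤ (M * Real.exp (-((k + 1) / M))) ^ p := by gcongr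
    _ = M ^ p * Real.exp (-((k + 1) / M) * p) := by
      rw [Real.mul_rpow hM.le (Real.exp_pos _).le, Real.exp_mul]
    _ ≤ M ^ p * (1 / 2 : ℝ) ^ (k + 1) := by
      gcongr
      calc Real.exp (-((k + 1) / M) * p) ≤ Real.exp (((k + 1 : ℕ) : ℝ) * (-1)) := by
            refine Real.exp_le_exp.mpr ?_
            have : 1 ≤ p / M := (one_le_div hM).mpr hMp
            have h := mul_le_mul_of_nonneg_left this (show (0 : ℝ) ≤ k + 1 by positivity)
            have e : -(((k : ℝ) + 1) / M) * p = -((k + 1) * (p / M)) := by ring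
            push_cast
            linarith
        _ = (Real.exp (-1)) ^ (k + 1) := by rw [← Real.exp_nat_mul]
        _ ≤ (1 / 2 : ℝ) ^ (k + 1) := by
            gcongr
            rw [Real.exp_neg, one_div]
            gcongr
            linarith [Real.add_one_le_exp 1]

theorem two_pi_mul_exp_one_pos : 0 < 2 * Real.pi * Real.exp 1 := by positivity

/-- Moving right by `K` costs only the bounded factor `exp (2πe K)`, which the `√p` in the lower
bound for `hurwitzConst p` outweighs. -/
theorem eventually_shiftSum_le {K δ : ℝ} (hK : 0 ≤ K) (hδ : 0 < δ) :
    ∀ᶠ p : ℝ in atTop, ∀ a : ℝ, a ≤ p / (2 * Real.pi * Real.exp 1) + K →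
      shiftSum p a / hurwitzConst p ≤ δ := by
  set c := 2 * Real.pi * Real.exp 1 with hc
  have hc0 : 0 < c := two_pi_mul_exp_one_pos
  have hc2 : 2 ≤ c := by nlinarith [Real.pi_gt_three, Real.add_one_le_exp 1]
  have hlim : Tendsto (fun p : ℝ => Real.exp (c * K) * Real.pi * (√p)⁻¹) atTop (𝓝 0) := by
    simpa using (tendsto_inv_atTop_zero.comp Real.tendsto_sqrt_atTop).const_mul
      (Real.exp (c * K) * Real.pi)
  filter_upwards [hlim.eventually_le_const hδ, eventually_ge_atTop 1,
    eventually_ge_atTop (2 * K)] with p hp hp1 hpK a ha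
  have hp0 : 0 < p := by linarith
  have hM : 0 < p / c + K := by positivity
  have hMp : p / c + K ≤ p := by
    have : p / c ≤ p / 2 := by gcongr
    linarith
  refine le_trans ?_ hp
  rw [div_le_iff₀ (hurwitzConst_pos hp0)]
  have h1 : (p / c + K) ^ p ≤ (p / c) ^ p * Real.exp (c * K) := by
    have e : Real.exp (c * K) = Real.exp (c * K / p) ^ p := by
      rw [← Real.exp_mul, div_mul_cancel₀ _ hp0.ne']
    rw [e, ← Real.mul_rpow (by positivity) (by positivity)]
    gcongr
    have h := mul_le_mul_of_nonneg_left (Real.add_one_le_exp (c * K / p))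
      (show 0 ≤ p / c by positivity)
    have e2 : p / c * (c * K / p + 1) = p / c + K := by field_simp; ring
    linarith
  have h3 : 0 < √p := Real.sqrt_pos.mpr hp0
  calc shiftSum p a ≤ (p / c + K) ^ p := shiftSum_le_rpow hM hMp ha
    _ ≤ (p / c) ^ p * Real.exp (c * K) := h1
    _ = Real.exp (c * K) * Real.pi * (√p)⁻¹ * (√p / Real.pi * (p / c) ^ p) := by
        field_simp
    _ ≤ _ := by
        gcongr
        exact le_hurwitzConst hp1

theorem shiftSum_nonneg (p a : ℝ) : 0 ≤ shiftSum p a :=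
  Finset.sum_nonneg fun _ _ => by positivity

theorem eventually_abs_normHurwitz_sub_sin_le {K δ : ℝ} (hK : 0 ≤ K) (hδ : 0 < δ) :
    ∀ᶠ p : ℝ in atTop, ∀ a : ℝ, a ≤ p / (2 * Real.pi * Real.exp 1) + K →
      |normHurwitz p a - Real.sin (2 * Real.pi * a - Real.pi * p / 2)| ≤ δ := by
  filter_upwards [eventually_abs_hurwitzSeries_sub_sin_le (half_pos hδ),
    eventually_shiftSum_le hK (half_pos hδ), eventually_gt_atTop 0] with p h1 h2 hp a ha
  have h1 := h1 a
  have h2 := h2 a ha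
  have h3 : 0 ≤ shiftSum p a / hurwitzConst p :=
    div_nonneg (shiftSum_nonneg p a) (hurwitzConst_pos hp).le
  rw [abs_le] at h1 ⊢
  rw [normHurwitz]
  constructor <;> linarith

/-- The logarithmic shift is chosen so that `(1 + log p / (2p)) ^ p` is asymptotic to `√p`. Then `(a
- 1) ^ p` alone outweighs the oscillation, as `21/20 * 22/25 < 19/20`. -/
theorem eventually_normHurwitz_neg :
    ∀ᶠ p : ℝ in atTop, ∀ a : ℝ,
      p / (2 * Real.pi * Real.exp 1) + 1 / (4 * Real.pi * Real.exp 1) * Real.log p + 1 ≤ a →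
        normHurwitz p a < 0 := by
  have hlim : Tendsto (fun p : ℝ => Real.exp (-((Real.log p) ^ 2 / p) / 4)) atTop (𝓝 1) := by
    have h1 : Tendsto (fun p : ℝ => -(Real.log p ^ 2 / p) / 4) atTop (𝓝 0) := by
      simpa using (Real.isLittleO_pow_log_id_atTop (n := 2)).tendsto_div_nhds_zero.neg.div_const 4
    have h := (Real.continuous_exp.tendsto 0).comp h1
    rw [Real.exp_zero] at h
    exact h
  filter_upwards [eventually_abs_hurwitzSeries_sub_sin_le (show (0 : ℝ) < 1 / 20 by norm_num),
    eventually_hurwitzConst_le, hlim.eventually_const_lt (show (19 / 20 : ℝ) < 1 by norm_num),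
    eventually_ge_atTop 1] with p hF hC hE hp a ha
  have hp0 : 0 < p := by linarith
  set c := 2 * Real.pi * Real.exp 1 with hc
  have hc0 : 0 < c := two_pi_mul_exp_one_pos
  have hlog : 0 ≤ Real.log p := Real.log_nonneg hp
  have hbase : p / c * (1 + Real.log p / (2 * p)) ≤ a - 1 := by
    have e : p / c * (1 + Real.log p / (2 * p))
        = p / c + 1 / (4 * Real.pi * Real.exp 1) * Real.log p := by
      rw [show 4 * Real.pi * Real.exp 1 = 2 * c by rw [hc]; ring]
      field_simp
    linarith
  have hpow : √p * (19 / 20) ≤ (1 + Real.log p / (2 * p)) ^ p := by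
    set y := Real.log p / (2 * p) with hy
    have hy0 : 0 ≤ y := by positivity
    have hl : 1 / 2 * Real.log p - Real.log p ^ 2 / p / 4 ≤ Real.log (1 + y) * p := by
      have h1 : y - y ^ 2 ≤ Real.log (1 + y) := by
        refine le_trans ?_ (Real.one_sub_inv_le_log_of_pos (by positivity))
        rw [← sub_nonneg]
        have e : 1 - (1 + y)⁻¹ - (y - y ^ 2) = y ^ 3 / (1 + y) := by field_simp; ring
        rw [e]
        positivity
      have h2 := mul_le_mul_of_nonneg_right h1 hp0.le
      have e : (y - y ^ 2) * p = 1 / 2 * Real.log p - Real.log p ^ 2 / p / 4 := by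
        rw [hy]; field_simp; ring
      linarith
    calc √p * (19 / 20) ≤ √p * Real.exp (-((Real.log p) ^ 2 / p) / 4) := by gcongr
      _ = Real.exp (1 / 2 * Real.log p - Real.log p ^ 2 / p / 4) := by
        rw [Real.sqrt_eq_rpow, Real.rpow_def_of_pos hp0, ← Real.exp_add]
        congr 1; ring
      _ ≤ Real.exp (Real.log (1 + y) * p) := Real.exp_le_exp.mpr hl
      _ = _ := (Real.rpow_def_of_pos (by positivity) p).symm
  have ha0 : 0 < a := by
    have : 0 ≤ p / c * (1 + Real.log p / (2 * p)) := by positivity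
    linarith
  have hS : (p / c) ^ p * (√p * (19 / 20)) ≤ shiftSum p a := by
    calc (p / c) ^ p * (√p * (19 / 20)) ≤ (p / c) ^ p * (1 + Real.log p / (2 * p)) ^ p := by
          gcongr
      _ = (p / c * (1 + Real.log p / (2 * p))) ^ p :=
          (Real.mul_rpow (by positivity) (by positivity)).symm
      _ ≤ (max (a - ((0 : ℕ) + 1)) 0) ^ p := by
          gcongr
          refine le_max_of_le_left ?_
          simpa using hbase
      _ ≤ shiftSum p a :=
          Finset.single_le_sum (f := fun k : ℕ => (max (a - (k + 1)) 0) ^ p)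
            (fun _ _ => by positivity) (Finset.mem_range.mpr (Nat.ceil_pos.mpr ha0))
  have hCp := hurwitzConst_pos hp0
  have hF1 : hurwitzSeries p a ≤ 21 / 20 := by
    have := (abs_le.mp (hF a)).2
    linarith [Real.sin_le_one (2 * Real.pi * a - Real.pi * p / 2)]
  have hW : 0 < √p * (p / c) ^ p := by positivity
  rw [normHurwitz, sub_neg, lt_div_iff₀ hCp]
  calc hurwitzSeries p a * hurwitzConst p ≤ 21 / 20 * hurwitzConst p := by gcongr
    _ ≤ 21 / 20 * (22 / 25 * √p * (p / c) ^ p) := by gcongr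
    _ < (p / c) ^ p * (√p * (19 / 20)) := by linarith
    _ ≤ _ := hS

/-! ### Counting zeros by repeated use of Rolle's theorem -/

/-- Iterable form of Rolle's theorem: between zeros of `f` there are zeros of its derivative. -/
theorem exists_finset_zeros_deriv {f f' : ℝ → ℝ} (hf : ∀ x, HasDerivAt f (f' x) x) {c : ℝ}
    (s : Finset ℝ) (hs : ∀ x ∈ s, c < x ∧ f x = 0) :
    ∃ t : Finset ℝ, s.card ≤ t.card + 1 ∧ ∀ x ∈ t, c < x ∧ f' x = 0 := by
  rcases Nat.eq_zero_or_pos s.card with h0 | hpos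
  · exact ⟨∅, by simp [h0], by simp⟩
  obtain ⟨n, hn⟩ := Nat.exists_eq_succ_of_ne_zero hpos.ne'
  let x := s.orderEmbOfFin hn
  have hx : ∀ i, c < x i ∧ f (x i) = 0 := fun i => hs _ (s.orderEmbOfFin_mem hn i)
  have hR : ∀ i : Fin n, ∃ y ∈ Set.Ioo (x i.castSucc) (x i.succ), f' y = 0 := fun i =>
    exists_hasDerivAt_eq_zero (x.strictMono Fin.castSucc_lt_succ)
      (fun z _ => (hf z).continuousAt.continuousWithinAt)
      ((hx _).2.trans (hx _).2.symm) fun z _ => hf z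
  choose y hy hy0 using hR
  have hmono : StrictMono y := fun i j hij =>
    (hy i).2.trans_le ((x.monotone (Fin.succ_le_castSucc_iff.mpr hij)).trans (hy j).1.le)
  refine ⟨Finset.univ.map ⟨y, hmono.injective⟩, by simp [hn], fun z hz => ?_⟩
  obtain ⟨i, -, rfl⟩ := Finset.mem_map.mp hz
  exact ⟨(hx _).1.trans (hy i).1, hy0 i⟩

/-- Each step from `p` to `p - 1` loses at most one zero, and after `m` steps none is left. -/
theorem card_zeros_normHurwitz_le (c : ℝ) (m : ℕ) {p : ℝ} (hp : (m : ℝ) < p)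
    (hne : ∀ x, c < x → normHurwitz (p - m) x ≠ 0) (s : Finset ℝ)
    (hs : ∀ x ∈ s, c < x ∧ normHurwitz p x = 0) : s.card ≤ m := by
  induction m generalizing p s with
  | zero =>
    have : s = ∅ := Finset.eq_empty_of_forall_notMem fun x hx =>
      hne x (hs x hx).1 (by simpa using (hs x hx).2)
    simp [this]
  | succ m ih =>
    push_cast at hp hne
    have hm : (0 : ℝ) ≤ m := m.cast_nonneg
    obtain ⟨t, hst, ht⟩ := exists_finset_zeros_deriv
      (hasDerivAt_normHurwitz (show 1 < p by linarith)) s hs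
    refine hst.trans (Nat.succ_le_succ (ih (p := p - 1) (by linarith) (fun x hx => ?_) t
      fun x hx => ⟨(ht x hx).1, ?_⟩))
    · rw [show p - 1 - m = p - (m + 1) by ring]
      exact hne x hx
    · have := (ht x hx).2
      rwa [mul_eq_zero, or_iff_right (by positivity)] at this

/-! ### Zeros in the oscillating range -/

/-- Jordan's inequality after reduction to the nearest integer; it turns a small sine into closeness
to the lattice. -/
theorem two_mul_abs_sub_round_le_abs_sin (y : ℝ) :
    2 * |y - round y| ≤ |Real.sin (Real.pi * y)| := by
  have h1 : |Real.sin (Real.pi * y)| = |Real.sin (Real.pi * (y - round y))| := by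
    rw [mul_sub, mul_comm _ (round y : ℝ), Real.sin_sub_int_mul_pi, abs_mul]
    simp [abs_zpow]
  have h2 : |Real.pi * (y - round y)| = Real.pi * |y - round y| := by
    rw [abs_mul, abs_of_pos Real.pi_pos]
  have h3 := Real.mul_abs_le_abs_sin (x := Real.pi * (y - round y)) (by
    rw [h2]
    nlinarith [abs_sub_round y, Real.pi_pos])
  rw [h1]
  refine le_trans (le_of_eq ?_) h3
  rw [h2]
  field_simp

theorem one_sub_le_abs_cos (y : ℝ) (l : ℤ) :
    1 - (Real.pi * (y - l)) ^ 2 / 2 ≤ |Real.cos (Real.pi * y)| := by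
  have h1 : |Real.cos (Real.pi * y)| = |Real.cos (Real.pi * (y - l))| := by
    rw [mul_sub, mul_comm _ (l : ℝ), Real.cos_sub_int_mul_pi, abs_mul]
    simp [abs_zpow]
  rw [h1]
  exact Real.one_sub_sq_div_two_le_cos.trans (le_abs_self _)

/-- `ζ(-p, ·)` has a zero between neighbouring extremal points of `sin (2πa - πp/2)`. -/
theorem exists_zero_between {p B : ℝ} (hp : 1 < p)
    (hB : ∀ a ≤ B, |normHurwitz p a - Real.sin (2 * Real.pi * a - Real.pi * p / 2)| ≤ 1 / 2)
    (j : ℤ) (hj : p / 4 + 3 / 4 + j / 2 ≤ B) :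
    ∃ z ∈ Set.Ioo (p / 4 + 1 / 4 + (j : ℝ) / 2) (p / 4 + 3 / 4 + j / 2),
      normHurwitz p z = 0 := by
  -- The sine equals `σ = ±1` at the left endpoint and `-σ` at the right one; multiplying by `σ`
  -- treats both parities of `j` at once.
  set σ := Real.cos (j * Real.pi) with hσ
  have hσ1 : σ * σ = 1 := by
    rw [hσ, Real.cos_int_mul_pi, ← mul_zpow]; simp
  have hσabs : |σ| = 1 := by
    rw [hσ, Real.cos_int_mul_pi]; simp [abs_zpow]
  have hsin1 : Real.sin (2 * Real.pi * (p / 4 + 1 / 4 + (j : ℝ) / 2) - Real.pi * p / 2) = σ := by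
    rw [hσ, ← Real.sin_add_pi_div_two]; congr 1; ring
  have hsin2 : Real.sin (2 * Real.pi * (p / 4 + 3 / 4 + (j : ℝ) / 2) - Real.pi * p / 2) = -σ := by
    rw [hσ, ← Real.cos_add_pi, ← Real.sin_add_pi_div_two]; congr 1; ring
  have hmul : ∀ x : ℝ, |σ * x| = |x| := fun x => by rw [abs_mul, hσabs, one_mul]
  have h1 := hB (p / 4 + 1 / 4 + (j : ℝ) / 2) (by linarith)
  have h2 := hB _ hj
  rw [hsin1, ← hmul, abs_le] at h1
  rw [hsin2, ← hmul, abs_le] at h2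
  have h0 : (0 : ℝ) ∈ Set.Ioo (σ * normHurwitz p (p / 4 + 3 / 4 + (j : ℝ) / 2))
      (σ * normHurwitz p (p / 4 + 1 / 4 + (j : ℝ) / 2)) := by
    constructor <;> linarith
  obtain ⟨z, hz, hz0⟩ := intermediate_value_Ioo' (by linarith)
    ((continuous_normHurwitz hp).const_smul σ).continuousOn h0
  refine ⟨z, hz, (mul_eq_zero.mp hz0).resolve_left fun h => ?_⟩
  rw [h] at hσ1
  simp at hσ1

theorem exists_strictMono_zeros {p B : ℝ} (hp : 1 < p)
    (hB : ∀ a ≤ B, |normHurwitz p a - Real.sin (2 * Real.pi * a - Real.pi * p / 2)| ≤ 1 / 2)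
    {n : ℕ} (hn : (n : ℝ) + 1 ≤ 2 * B) :
    ∃ z : Fin n → ℝ, StrictMono z ∧ ∀ i, z i ∈ realZeros p ∧ (i : ℝ) / 2 < z i := by
  -- The least `j` whose interval has a positive left endpoint; that endpoint is then at most `1/2`.
  set j₀ : ℤ := ⌊-p / 2 - 1 / 2⌋ + 1 with hj
  have hj1 : -p / 2 - 1 / 2 < j₀ := by
    rw [hj]; push_cast; exact Int.lt_floor_add_one _
  have hj2 : (j₀ : ℝ) ≤ -p / 2 + 1 / 2 := by
    rw [hj]; push_cast; linarith [Int.floor_le (-p / 2 - 1 / 2)]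
  have hex : ∀ i : Fin n, ∃ z ∈ Set.Ioo (p / 4 + 1 / 4 + ((j₀ + (i : ℕ) : ℤ) : ℝ) / 2)
      (p / 4 + 3 / 4 + ((j₀ + (i : ℕ) : ℤ) : ℝ) / 2), normHurwitz p z = 0 := fun i => by
    refine exists_zero_between hp hB _ ?_
    have : ((i : ℕ) : ℝ) + 1 ≤ n := by exact_mod_cast i.2
    push_cast
    linarith
  choose z hz hz0 using hex
  push_cast at hz
  refine ⟨z, fun i k hik => (hz i).2.trans_le (le_trans ?_ (hz k).1.le), fun i => ?_⟩
  · have : ((i : ℕ) : ℝ) + 1 ≤ (k : ℕ) := by exact_mod_cast hik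
    linarith
  · have h1 := (hz i).1
    have h2 : ((i : ℕ) : ℝ) / 2 < z i := by linarith
    have h3 : (0 : ℝ) ≤ ((i : ℕ) : ℝ) / 2 := by positivity
    exact ⟨(mem_realZeros_iff (by linarith)).mpr ⟨by linarith, hz0 i⟩, h2⟩

/-- Where `ζ(-p, ·)` and its derivative are close to trigonometric functions, distinct zeros
have distinct nearest points of the lattice `p / 4 + ℤ / 2`. -/
theorem card_zeros_le_of_approx {p B : ℝ} (hp : 1 < p)
    (h0 : ∀ a ≤ B, |normHurwitz p a - Real.sin (2 * Real.pi * a - Real.pi * p / 2)| ≤ 1 / 4)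
    (h1 : ∀ a ≤ B,
      |normHurwitz (p - 1) a - Real.sin (2 * Real.pi * a - Real.pi * (p - 1) / 2)| ≤ 1 / 4)
    (hB : 0 ≤ B) (s : Finset ℝ) (hs : ∀ x ∈ s, x ∈ realZeros p ∧ x ≤ B) :
    (s.card : ℝ) ≤ 2 * B + 3 := by
  have hz : ∀ x ∈ s, normHurwitz p x = 0 := fun x hx =>
    ((mem_realZeros_iff (by linarith)).mp (hs x hx).1).2
  have hclose : ∀ x ∈ s, |2 * x - p / 2 - round (2 * x - p / 2)| ≤ 1 / 8 := fun x hx => by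
    have h2 := h0 x (hs x hx).2
    rw [hz x hx, zero_sub, abs_neg] at h2
    have h3 := two_mul_abs_sub_round_le_abs_sin (2 * x - p / 2)
    rw [show Real.pi * (2 * x - p / 2) = 2 * Real.pi * x - Real.pi * p / 2 by ring] at h3
    linarith
  -- Otherwise Rolle gives a zero `c` of the derivative near the same lattice point. There the
  -- cosine is at most `1/4` in absolute value, yet at least `1 - π² / 128 ≥ 7/8`.
  have hinj : ∀ x ∈ s, ∀ y ∈ s, x < y → round (2 * x - p / 2) ≠ round (2 * y - p / 2) := by
    intro x hx y hy hxy hr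
    obtain ⟨c, hc, hc0⟩ := exists_hasDerivAt_eq_zero hxy
      (continuous_normHurwitz hp).continuousOn ((hz x hx).trans (hz y hy).symm)
      fun z _ => hasDerivAt_normHurwitz hp z
    rw [mul_eq_zero, or_iff_right (by positivity)] at hc0
    have hx1 := abs_le.mp (hclose x hx)
    have hy1 := abs_le.mp (hclose y hy)
    rw [← hr] at hy1
    have h2 := h1 c (hc.2.le.trans (hs y hy).2)
    rw [hc0, zero_sub, abs_neg, show 2 * Real.pi * c - Real.pi * (p - 1) / 2
      = Real.pi * (2 * c - p / 2) + Real.pi / 2 by ring, Real.sin_add_pi_div_two] at h2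
    have h3 := one_sub_le_abs_cos (2 * c - p / 2) (round (2 * x - p / 2))
    have h4 : (2 * c - p / 2 - round (2 * x - p / 2)) ^ 2 ≤ (1 / 8) ^ 2 :=
      sq_le_sq' (by linarith [hc.1]) (by linarith [hc.2])
    have h5 : Real.pi ^ 2 ≤ 4 ^ 2 := by
      have := Real.pi_le_four
      gcongr
    rw [mul_pow] at h3
    have h6 := mul_le_mul h5 h4 (sq_nonneg _) (by positivity)
    linarith
  have hmaps : ∀ x ∈ s, round (2 * x - p / 2) ∈ Finset.Icc ⌊-p / 2⌋ ⌈2 * B - p / 2⌉ := by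
    intro x hx
    obtain ⟨⟨hx0, -⟩, hxB⟩ := hs x hx
    have h2 := abs_le.mp (hclose x hx)
    rw [Finset.mem_Icc, ← Int.lt_add_one_iff, ← Int.lt_add_one_iff]
    have h3 := Int.floor_le (-p / 2)
    have h4 := Int.le_ceil (2 * B - p / 2)
    constructor
    · have : ((⌊-p / 2⌋ : ℤ) : ℝ) < round (2 * x - p / 2) + 1 := by linarith
      exact_mod_cast this
    · have : ((round (2 * x - p / 2) : ℤ) : ℝ) < ⌈2 * B - p / 2⌉ + 1 := by linarith
      exact_mod_cast this
  have hcard := Finset.card_le_card_of_injOn _ hmaps fun x hx y hy hxy => by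
    rcases lt_trichotomy x y with h | h | h
    · exact absurd hxy (hinj x hx y hy h)
    · exact h
    · exact absurd hxy.symm (hinj y hy x hx h)
  rw [Int.card_Icc] at hcard
  have h3 := Int.lt_floor_add_one (-p / 2)
  have h4 := Int.ceil_lt_add_one (2 * B - p / 2)
  have h5 : (0 : ℤ) ≤ ⌈2 * B - p / 2⌉ + 1 - ⌊-p / 2⌋ := by
    have h6 := Int.floor_le (-p / 2)
    have h7 := Int.le_ceil (2 * B - p / 2)
    have : (0 : ℝ) ≤ ⌈2 * B - p / 2⌉ + 1 - ⌊-p / 2⌋ := by linarith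
    exact_mod_cast this
  have h8 : ((⌈2 * B - p / 2⌉ + 1 - ⌊-p / 2⌋).toNat : ℝ)
      = ⌈2 * B - p / 2⌉ + 1 - ⌊-p / 2⌋ := by
    have := Int.toNat_of_nonneg h5
    exact_mod_cast congrArg (Int.cast : ℤ → ℝ) this
  have h9 : (s.card : ℝ) ≤ (⌈2 * B - p / 2⌉ + 1 - ⌊-p / 2⌋).toNat := by exact_mod_cast hcard
  linarith

/-! ### Number, size, simplicity and location of the zeros -/

theorem tendsto_sub_one_atTop : Tendsto (fun p : ℝ => p - 1) atTop atTop :=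
  tendsto_atTop_add_const_right _ (-1) tendsto_id

theorem eventually_card_zeros_lt :
    ∀ᶠ p : ℝ in atTop, ∀ s : Finset ℝ, (∀ x ∈ s, x ∈ realZeros p) →
      (s.card : ℝ) < (p - 1) / (Real.pi * Real.exp 1) + 1 / 2 * Real.log p
        + 2 * Real.pi * Real.exp 1 + 2 := by
  obtain ⟨Q, hQ⟩ := eventually_atTop.mp eventually_normHurwitz_neg
  have hK : (0 : ℝ) ≤ 1 / 2 := by norm_num
  have hδ : (0 : ℝ) < 1 / 4 := by norm_num
  filter_upwards [eventually_abs_normHurwitz_sub_sin_le hK hδ,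
    tendsto_sub_one_atTop.eventually (eventually_abs_normHurwitz_sub_sin_le hK hδ),
    eventually_ge_atTop (2 * (max Q 1 + Real.pi * Real.exp 1 + 2)),
    eventually_gt_atTop 1] with p h0 h1 hpQ hp s hs
  set d := Real.pi * Real.exp 1 with hd
  -- The two counts give less than `(2 * B + 3) + (log p / 2 + d + 2)`, whose constant part `d + 6`
  -- is at most `2 * d + 2`.
  have hd4 : 4 ≤ d := by nlinarith [Real.pi_gt_three, Real.add_one_le_exp 1]
  have hd0 : 0 < d := by linarith
  have e2 : 2 * Real.pi * Real.exp 1 = 2 * d := by rw [hd]; ring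
  have e4 : 4 * Real.pi * Real.exp 1 = 4 * d := by rw [hd]; ring
  rw [e2] at h0 h1 ⊢
  simp only [e2, e4] at hQ
  -- Using `p - 1` here keeps the sine approximation valid up to `B` for the derivative too.
  set B := (p - 1) / (2 * d) + 1 / 2 with hB
  have hBp : B ≤ p / (2 * d) + 1 / 2 := by
    rw [hB]; gcongr; linarith
  have hB0 : 0 ≤ B := add_nonneg (div_nonneg (by linarith) (by linarith)) hK
  have hlow := card_zeros_le_of_approx hp (fun a ha => h0 a (ha.trans hBp)) h1 hB0
    (s.filter (· ≤ B)) fun x hx => ⟨hs x (Finset.mem_filter.mp hx).1, (Finset.mem_filter.mp hx).2⟩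
  have hlog0 : 0 ≤ Real.log p := Real.log_nonneg hp.le
  have hlogp : Real.log p ≤ p := (Real.log_le_sub_one_of_pos (by linarith)).trans (by linarith)
  -- The size of `m` needed for the threshold of negativity at `p - m` to lie at or left of `B`;
  -- since `log p ≤ p`, `p - m` still exceeds `Q`.
  set m := ⌈1 / 2 * Real.log p + d + 1⌉₊ with hm
  have hm1 : 1 / 2 * Real.log p + d + 1 ≤ m := Nat.le_ceil _
  have hm2 : (m : ℝ) < 1 / 2 * Real.log p + d + 1 + 1 := Nat.ceil_lt_add_one (by positivity)
  have hmax1 := le_max_left Q 1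
  have hmax2 := le_max_right Q 1
  have hhigh := card_zeros_normHurwitz_le B m (p := p) (by linarith) (fun x hx => by
      refine (hQ (p - m) (by linarith) x (le_trans ?_ hx.le)).ne
      have hl : Real.log (p - m) ≤ Real.log p :=
        Real.log_le_log (by linarith) (by linarith [m.cast_nonneg (α := ℝ)])
      have e : (p - 1) / (2 * d) + 1 / 2
          - ((p - m) / (2 * d) + 1 / (4 * d) * Real.log (p - m) + 1)
          = (2 * m - 2 - 2 * d - Real.log (p - m)) / (4 * d) := by
        field_simp
        ring
      have : 0 ≤ (2 * m - 2 - 2 * d - Real.log (p - m)) / (4 * d) :=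
        div_nonneg (by linarith) (by linarith)
      linarith)
    (s.filter (¬ · ≤ B)) fun x hx => by
      obtain ⟨hxs, hxB⟩ := Finset.mem_filter.mp hx
      exact ⟨not_le.mp hxB, ((mem_realZeros_iff (by linarith)).mp (hs x hxs)).2⟩
  have hhigh' : ((s.filter (¬ · ≤ B)).card : ℝ) ≤ m := by exact_mod_cast hhigh
  have hsum : (s.card : ℝ) = (s.filter (· ≤ B)).card + (s.filter (¬ · ≤ B)).card := by
    exact_mod_cast (Finset.card_filter_add_card_filter_not (s := s) (· ≤ B)).symm
  have eB : 2 * B = (p - 1) / d + 1 := by rw [hB]; field_simp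
  linarith

theorem eventually_finite_realZeros :
    ∀ᶠ p : ℝ in atTop, (realZeros p).Finite ∧
      (numRealZeros p : ℝ) < (p - 1) / (Real.pi * Real.exp 1) + 1 / 2 * Real.log p
        + 2 * Real.pi * Real.exp 1 + 2 := by
  filter_upwards [eventually_card_zeros_lt] with p h
  have hfin : (realZeros p).Finite := by
    by_contra hinf
    obtain ⟨n, hn⟩ := exists_nat_gt ((p - 1) / (Real.pi * Real.exp 1) + 1 / 2 * Real.log p
        + 2 * Real.pi * Real.exp 1 + 2)
    obtain ⟨t, ht, htn⟩ := Set.Infinite.exists_subset_card_eq hinf n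
    have := h t fun x hx => ht hx
    rw [htn] at this
    linarith
  refine ⟨hfin, ?_⟩
  rw [numRealZeros, Set.ncard_eq_toFinset_card _ hfin]
  exact h _ fun x hx => hfin.mem_toFinset.mp hx

theorem eventually_exists_greatest_zero :
    ∀ᶠ p : ℝ in atTop,
      (∃ A : ℝ, IsGreatest (realZeros p) A ∧
        (p - 1) / (2 * Real.pi * Real.exp 1) - 1 / 2 < A ∧
        A < p / (2 * Real.pi * Real.exp 1)
            + 1 / (4 * Real.pi * Real.exp 1) * Real.log p + 1) ∧
      (p - 1) / (Real.pi * Real.exp 1) - 1 < (numRealZeros p : ℝ) := by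
  filter_upwards [eventually_abs_normHurwitz_sub_sin_le (show (0 : ℝ) ≤ 2 by norm_num)
    (show (0 : ℝ) < 1 / 2 by norm_num), eventually_normHurwitz_neg, eventually_finite_realZeros,
    eventually_gt_atTop 1] with p happ hneg hfin hp
  have hd0 : 0 < 2 * Real.pi * Real.exp 1 := two_pi_mul_exp_one_pos
  have hlt : (p - 1) / (2 * Real.pi * Real.exp 1) < p / (2 * Real.pi * Real.exp 1) := by
    gcongr
    linarith
  have e2 : (p - 1) / (Real.pi * Real.exp 1) = 2 * ((p - 1) / (2 * Real.pi * Real.exp 1)) := by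
    field_simp
  set B := p / (2 * Real.pi * Real.exp 1) + 2 with hB
  have hB2 : 2 < B := by
    have : 0 < p / (2 * Real.pi * Real.exp 1) := div_pos (by linarith) hd0
    linarith
  -- The most zeros that the interval construction yields below `B`; the last one exceeds `(n - 1) /
  -- 2`.
  set n := ⌊2 * B - 1⌋₊ with hn
  have hn1 : (n : ℝ) ≤ 2 * B - 1 := Nat.floor_le (by linarith)
  have hn2 : 2 * B - 1 < n + 1 := Nat.lt_floor_add_one _
  have hn0 : 0 < n := Nat.floor_pos.mpr (by linarith)
  obtain ⟨z, hzmono, hz⟩ := exists_strictMono_zeros hp happ (n := n) (by linarith)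
  refine ⟨?_, ?_⟩
  · let k : Fin n := ⟨n - 1, by omega⟩
    obtain ⟨A, hA⟩ := hfin.1.exists_maximal ⟨z k, (hz k).1⟩
    have hAg : IsGreatest (realZeros p) A :=
      ⟨hA.prop, fun x hx => (le_total x A).elim id fun h => hA.le_of_ge hx h⟩
    refine ⟨A, hAg, ?_, ?_⟩
    · have h1 := (hz k).2
      have h2 := hAg.2 (hz k).1
      have h3 : (((k : Fin n) : ℕ) : ℝ) = n - 1 := by
        simp only [k]
        rw [Nat.cast_sub hn0, Nat.cast_one]
      rw [h3] at h1
      linarith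
    · by_contra! h
      exact (hneg A h).ne ((mem_realZeros_iff (by linarith)).mp hAg.1).2
  · have h1 : (Set.range z).ncard ≤ numRealZeros p :=
      Set.ncard_le_ncard (Set.range_subset_iff.mpr fun i => (hz i).1) hfin.1
    rw [Set.ncard_range_of_injective hzmono.injective, Nat.card_eq_fintype_card,
      Fintype.card_fin] at h1
    have h2 : (n : ℝ) ≤ numRealZeros p := by exact_mod_cast h1
    linarith

/-- At a double zero the sine and the cosine of one angle would both be at most `1/2` in absolute
value, contradicting `sin² + cos² = 1`. -/
theorem eventually_zeros_simple :
    ∀ᶠ p : ℝ in atTop, ∀ a ∈ realZeros p, a < (p - 1) / (2 * Real.pi * Real.exp 1) →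
      ∃ d : ℂ, d ≠ 0 ∧ HasDerivAt (fun x : ℝ => hurwitz (-(p : ℂ)) x) d a := by
  have hδ : (0 : ℝ) < 1 / 2 := by norm_num
  filter_upwards [eventually_abs_normHurwitz_sub_sin_le le_rfl hδ,
    tendsto_sub_one_atTop.eventually (eventually_abs_normHurwitz_sub_sin_le le_rfl hδ),
    eventually_gt_atTop 1] with p h0 h1 hp a ha hap
  have hp0 : 0 < p := by linarith
  refine ⟨_, ?_, hasDerivAt_hurwitz hp ha.1⟩
  have hlt : (p - 1) / (2 * Real.pi * Real.exp 1) < p / (2 * Real.pi * Real.exp 1) := by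
    gcongr
    linarith
  have h2 := h0 a (by linarith)
  have h3 := h1 a (by linarith)
  rw [((mem_realZeros_iff hp0).mp ha).2, zero_sub, abs_neg] at h2
  intro hzero
  rw [Complex.ofReal_eq_zero, mul_eq_zero, or_iff_right (hurwitzConst_pos hp0).ne',
    mul_eq_zero, or_iff_right (by positivity)] at hzero
  rw [hzero, zero_sub, abs_neg, show 2 * Real.pi * a - Real.pi * (p - 1) / 2
    = 2 * Real.pi * a - Real.pi * p / 2 + Real.pi / 2 by ring, Real.sin_add_pi_div_two] at h3
  have h4 := Real.sin_sq_add_cos_sq (2 * Real.pi * a - Real.pi * p / 2)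
  have h5 := sq_le_sq' (abs_le.mp h2).1 (abs_le.mp h2).2
  have h6 := sq_le_sq' (abs_le.mp h3).1 (abs_le.mp h3).2
  linarith

theorem eventually_zeros_near_lattice {ε : ℝ} (hε : 0 < ε) :
    ∀ᶠ p : ℝ in atTop, ∀ a ∈ realZeros p, a < (p - 1) / (2 * Real.pi * Real.exp 1) →
      ∃ l : ℤ, |a - (p / 4 + (l : ℝ) / 2)| < ε := by
  filter_upwards [eventually_abs_normHurwitz_sub_sin_le le_rfl hε,
    eventually_gt_atTop 1] with p h0 hp a ha hap
  have hlt : (p - 1) / (2 * Real.pi * Real.exp 1) < p / (2 * Real.pi * Real.exp 1) := by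
    gcongr
    linarith
  have h2 := h0 a (by linarith)
  rw [((mem_realZeros_iff (by linarith)).mp ha).2, zero_sub, abs_neg] at h2
  have h3 := two_mul_abs_sub_round_le_abs_sin (2 * a - p / 2)
  rw [show Real.pi * (2 * a - p / 2) = 2 * Real.pi * a - Real.pi * p / 2 by ring] at h3
  refine ⟨round (2 * a - p / 2), ?_⟩
  rw [show a - (p / 4 + (round (2 * a - p / 2) : ℝ) / 2)
    = (2 * a - p / 2 - round (2 * a - p / 2)) / 2 by ring, abs_div, abs_two]
  linarith

theorem tendsto_numRealZeros_div :
    Tendsto (fun p : ℝ => (numRealZeros p : ℝ) / p) atTop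
      (𝓝 (1 / (Real.pi * Real.exp 1))) := by
  have hinv : Tendsto (fun p : ℝ => p⁻¹) atTop (𝓝 0) := tendsto_inv_atTop_zero
  have hlog : Tendsto (fun p : ℝ => Real.log p / p) atTop (𝓝 0) :=
    Real.isLittleO_log_id_atTop.tendsto_div_nhds_zero
  have hlow : Tendsto (fun p : ℝ => (1 - p⁻¹) / (Real.pi * Real.exp 1) - p⁻¹) atTop
      (𝓝 (1 / (Real.pi * Real.exp 1))) := by
    simpa using ((hinv.const_sub 1).div_const (Real.pi * Real.exp 1)).sub hinv
  have hup : Tendsto (fun p : ℝ => (1 - p⁻¹) / (Real.pi * Real.exp 1)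
      + 1 / 2 * (Real.log p / p) + (2 * Real.pi * Real.exp 1 + 2) * p⁻¹) atTop
      (𝓝 (1 / (Real.pi * Real.exp 1))) := by
    have h := (((hinv.const_sub 1).div_const (Real.pi * Real.exp 1)).add
      (hlog.const_mul (1 / 2))).add (hinv.const_mul (2 * Real.pi * Real.exp 1 + 2))
    rwa [sub_zero, mul_zero, mul_zero, add_zero, add_zero] at h
  refine tendsto_of_tendsto_of_tendsto_of_le_of_le' hlow hup ?_ ?_
  · filter_upwards [eventually_exists_greatest_zero, eventually_gt_atTop 0] with p h hp
    rw [le_div_iff₀ hp]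
    refine le_trans (le_of_eq ?_) h.2.le
    field_simp
  · filter_upwards [eventually_finite_realZeros, eventually_gt_atTop 0] with p h hp
    rw [div_le_iff₀ hp]
    refine h.2.le.trans (le_of_eq ?_)
    field_simp
    ring

theorem exists_one_lt_of_eventually {q : ℝ → Prop} (h : ∀ᶠ p : ℝ in atTop, q p) :
    ∃ P : ℝ, 1 < P ∧ ∀ p : ℝ, P < p → q p := by
  obtain ⟨P, hP⟩ := eventually_atTop.mp h
  exact ⟨max P 2, lt_max_of_lt_right one_lt_two, fun p hp => hP p ((le_max_left P 2).trans hp.le)⟩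

theorem theorem3 :
    (∃ P : ℝ, 1 < P ∧ ∀ p : ℝ, P < p →
      (realZeros p).Finite ∧
      (∃ A : ℝ, IsGreatest (realZeros p) A ∧
        (p - 1) / (2 * Real.pi * Real.exp 1) - 1 / 2 < A ∧
        A < p / (2 * Real.pi * Real.exp 1)
            + 1 / (4 * Real.pi * Real.exp 1) * Real.log p + 1) ∧
      (p - 1) / (Real.pi * Real.exp 1) - 1 < (numRealZeros p : ℝ) ∧
      (numRealZeros p : ℝ) < (p - 1) / (Real.pi * Real.exp 1) + 1 / 2 * Real.log p
          + 2 * Real.pi * Real.exp 1 + 2 ∧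
      (∀ a ∈ realZeros p, a < (p - 1) / (2 * Real.pi * Real.exp 1) →
        ∃ d : ℂ, d ≠ 0 ∧ HasDerivAt (fun x : ℝ => hurwitz (-(p : ℂ)) x) d a)) ∧
    Tendsto (fun p : ℝ => (numRealZeros p : ℝ) / p) atTop
      (𝓝 (1 / (Real.pi * Real.exp 1))) ∧
    (∀ ε : ℝ, 0 < ε → ∃ P : ℝ, 1 < P ∧ ∀ p : ℝ, P < p →
      ∀ a ∈ realZeros p, a < (p - 1) / (2 * Real.pi * Real.exp 1) →
        ∃ l : ℤ, |a - (p / 4 + (l : ℝ) / 2)| < ε) := by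
  refine ⟨exists_one_lt_of_eventually ?_, tendsto_numRealZeros_div, fun ε hε =>
    exists_one_lt_of_eventually (eventually_zeros_near_lattice hε)⟩
  filter_upwards [eventually_finite_realZeros, eventually_exists_greatest_zero,
    eventually_zeros_simple] with p h1 h2 h3
  exact ⟨h1.1, h2.1, h2.2, h1.2, h3⟩
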